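/- Let $n\ge 3$, let $\mathbb S^n\subset\mathbb R^{n+1}$ be the unit sphere with its standard round metric, let $\Delta_{\mathbb S^n}$ be its Laplace–Beltrami operator, and let $\mathcal L_{\mathbb S^n}:=\Delta_{\mathbb S^n}-\frac{n(n-2)}{4}$ be the conformal Laplacian. Let $f:[0,\infty)\to\mathbb R$ be a continuous function such that $s\mapsto s^{-(n+2)/(n-2)}f(s)$ is strictly decreasing on $(0,\infty)$. Then every solution $v\in C^2(\mathbb S^n)$ of $$-\mathcal L_{\mathbb S^n}v=f(v)\quad\text{and}\quad v>0\quad\text{on }\mathbb S^n$$ is a constant, $v\equiv c$ on $\mathbb S^n$, and $c$ satisfies $f(c)=\frac{n(n-2)}{4}\,c$. -/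

import Mathlib

open scoped Manifold ContDiff

noncomputable section

/-- The round unit sphere `𝕊ⁿ = {θ ∈ ℝⁿ⁺¹ : |θ| = 1}`, with the smooth structure that Mathlib puts
on it (stereographic charts). -/
abbrev UnitSphere (n : ℕ) : Type :=
  Metric.sphere (0 : EuclideanSpace ℝ (Fin (n + 1))) 1

/-- The radial projection `y ↦ y / |y|` of `ℝⁿ⁺¹ \ {0}` onto `𝕊ⁿ`. -/
def radialProj {n : ℕ} (y : EuclideanSpace ℝ (Fin (n + 1))) (hy : y ≠ 0) : UnitSphere n :=
  ⟨‖y‖⁻¹ • y, by simp [norm_smul, norm_ne_zero_iff.mpr hy]⟩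

open Classical in
/-- The extension of a function `v` on `𝕊ⁿ` to `ℝⁿ⁺¹ \ {0}` that is constant along the normals of
the sphere, `y ↦ v (y / |y|)`. (The value `0` at the origin plays no role.) -/
def normalExtension {n : ℕ} (v : UnitSphere n → ℝ) (y : EuclideanSpace ℝ (Fin (n + 1))) : ℝ :=
  if hy : y ≠ 0 then v (radialProj y hy) else 0

/-- The Laplace-Beltrami operator `Δ_{𝕊ⁿ}` of the round sphere, for functions of class `C²`: the
Euclidean Laplacian in `ℝⁿ⁺¹` of the normal extension `y ↦ v (y / |y|)`, restricted to `𝕊ⁿ`. As the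
extension is constant along the normals, and `t ↦ (θ + t e) / |θ + t e|` is, for a unit tangent
vector `e` at `θ`, the great circle through `θ` with velocity `e` and zero geodesic acceleration at
`t = 0`, this is the sum of the second derivatives of `v` along the geodesics from `θ` in `n`
orthonormal directions, i.e. the trace of the Riemannian Hessian of `v`. -/
def sphereLaplacian {n : ℕ} (v : UnitSphere n → ℝ) (θ : UnitSphere n) : ℝ :=
  Laplacian.laplacian (normalExtension v) (θ : EuclideanSpace ℝ (Fin (n + 1)))

/-- The conformal Laplacian `𝓛_{𝕊ⁿ} = Δ_{𝕊ⁿ} - n (n - 2) / 4`. -/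
def conformalLaplacian {n : ℕ} (v : UnitSphere n → ℝ) (θ : UnitSphere n) : ℝ :=
  sphereLaplacian v θ - (n : ℝ) * ((n : ℝ) - 2) / 4 * v θ

end

/-! ### Second-order jets of curves, and second derivatives along lines. -/

section Jets

open Filter Topology

/-! Moving spheres, carried out on the light cone. Extend `v` to `U`, homogeneous of degree `k =
-(n-2)/2` on `ℝⁿ⁺¹ \ {0}`. At unit vectors the Euclidean Laplacian of `U` is the conformal Laplacian
of `v` (`laplacian_conformalExtension`). Identify `x` with the light-like vector `(x, ‖x‖)`: for `1
< ‖P‖` the Lorentz reflection in `(P, 1)` becomes a map `T = coneReflection P`, and precomposition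
with `T` commutes with the Laplacian on functions of degree `k`
(`sum_second_deriv_comp_coneReflection`). So no Kelvin transforms or conformal factors have to be
tracked.

With `p = (n+2)/(n-2)` and `g s = s ^ (-p) * f s`, the reflected function `W = U ∘ T` satisfies `-ΔW
= W ^ p * g (‖T x‖ ^ (-k) * W)` on the unit sphere where `lightForm P` is positive, and there `1 <
‖T x‖`. As `g` is strictly decreasing, `W` cannot touch `U` from below at such a point
(`false_of_touching`, `lt_of_dominatesReflection`).

An explicit barrier gives a maximum principle in narrow regions (`exists_narrow`). It shows `W ≤ U`
on the side not visible from `P` when `P` is close to the sphere, and together with the absence of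
touching it propagates this to all `P = τ • w` with `1 < τ` (`dominatesReflection`). As `τ → ∞` the
map `T` tends to the Euclidean reflection in the hyperplane orthogonal to `w`. Any two points of the
sphere are exchanged by such a reflection, so `v` takes the same value at both (`le_on_sphere`). -/

/-- The curve `γ` has value `c₀`, velocity `c₁` and acceleration `c₂` at time `0`. -/
def HasJet {F : Type*} [NormedAddCommGroup F] [NormedSpace ℝ F] (γ : ℝ → F) (c₀ c₁ c₂ : F) : Prop :=
  ∃ γ' : ℝ → F, (∀ᶠ t in 𝓝 0, HasDerivAt γ (γ' t) t) ∧ HasDerivAt γ' c₂ 0 ∧ γ 0 = c₀ ∧ γ' 0 = c₁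

namespace HasJet

variable {F : Type*} [NormedAddCommGroup F] [NormedSpace ℝ F] {γ δ : ℝ → F} {c₀ c₁ c₂ d₀ d₁ d₂ : F}

theorem continuousAt (h : HasJet γ c₀ c₁ c₂) : ContinuousAt γ 0 := by
  obtain ⟨γ', h1, -⟩ := h
  exact h1.self_of_nhds.continuousAt

theorem congr_jet (h : HasJet γ c₀ c₁ c₂) (h₀ : c₀ = d₀) (h₁ : c₁ = d₁) (h₂ : c₂ = d₂) :
    HasJet γ d₀ d₁ d₂ := by
  subst h₀ h₁ h₂; exact h

theorem deriv_deriv_eq (h : HasJet γ c₀ c₁ c₂) : deriv (deriv γ) 0 = c₂ := by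
  obtain ⟨γ', h1, h2, -, h4⟩ := h
  have : deriv γ =ᶠ[𝓝 0] γ' := h1.mono fun t ht => ht.deriv
  rw [this.deriv_eq, h2.deriv]

theorem affine (x e : F) : HasJet (fun t : ℝ => x + t • e) x e 0 := by
  refine ⟨fun _ => e, Eventually.of_forall fun t => ?_, hasDerivAt_const _ _, by simp, rfl⟩
  simpa using ((hasDerivAt_id t).smul_const e).const_add x

theorem const (x : F) : HasJet (fun _ : ℝ => x) x 0 0 :=
  ⟨fun _ => 0, Eventually.of_forall fun _ => hasDerivAt_const _ _, hasDerivAt_const _ _, rfl, rfl⟩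

theorem add (h : HasJet γ c₀ c₁ c₂) (k : HasJet δ d₀ d₁ d₂) :
    HasJet (fun t => γ t + δ t) (c₀ + d₀) (c₁ + d₁) (c₂ + d₂) := by
  obtain ⟨γ', h1, h2, h3, h4⟩ := h
  obtain ⟨δ', k1, k2, k3, k4⟩ := k
  refine ⟨fun t => γ' t + δ' t, ?_, h2.add k2, by simp [h3, k3], by simp [h4, k4]⟩
  filter_upwards [h1, k1] with t ht kt using ht.add kt

theorem sub (h : HasJet γ c₀ c₁ c₂) (k : HasJet δ d₀ d₁ d₂) :
    HasJet (fun t => γ t - δ t) (c₀ - d₀) (c₁ - d₁) (c₂ - d₂) := by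
  obtain ⟨γ', h1, h2, h3, h4⟩ := h
  obtain ⟨δ', k1, k2, k3, k4⟩ := k
  refine ⟨fun t => γ' t - δ' t, ?_, h2.sub k2, by simp [h3, k3], by simp [h4, k4]⟩
  filter_upwards [h1, k1] with t ht kt using ht.sub kt

theorem smul {r : ℝ → ℝ} {r₀ r₁ r₂ : ℝ} (hr : HasJet r r₀ r₁ r₂) (h : HasJet γ c₀ c₁ c₂) :
    HasJet (fun t => r t • γ t) (r₀ • c₀) (r₀ • c₁ + r₁ • c₀)
      (r₀ • c₂ + (2 * r₁) • c₁ + r₂ • c₀) := by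
  obtain ⟨γ', h1, h2, h3, h4⟩ := h
  obtain ⟨r', k1, k2, k3, k4⟩ := hr
  refine ⟨fun t => r t • γ' t + r' t • γ t, ?_, ?_, by simp [h3, k3], by simp [h3, h4, k3, k4]⟩
  · filter_upwards [h1, k1] with t ht kt using kt.smul ht
  · have := (k1.self_of_nhds.smul h2).add (k2.smul h1.self_of_nhds)
    rw [h3, h4, k3, k4] at this
    convert! this using 1
    module

theorem mul {r s : ℝ → ℝ} {r₀ r₁ r₂ s₀ s₁ s₂ : ℝ} (hr : HasJet r r₀ r₁ r₂)
    (hs : HasJet s s₀ s₁ s₂) :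
    HasJet (fun t => r t * s t) (r₀ * s₀) (r₀ * s₁ + r₁ * s₀) (r₀ * s₂ + 2 * r₁ * s₁ + r₂ * s₀) :=
  hr.smul hs

theorem clm {G : Type*} [NormedAddCommGroup G] [NormedSpace ℝ G] (A : F →L[ℝ] G)
    (h : HasJet γ c₀ c₁ c₂) : HasJet (fun t => A (γ t)) (A c₀) (A c₁) (A c₂) := by
  obtain ⟨γ', h1, h2, h3, h4⟩ := h
  refine ⟨fun t => A (γ' t), ?_, A.hasFDerivAt.comp_hasDerivAt _ h2, by simp [h3], by simp [h4]⟩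
  filter_upwards [h1] with t ht using A.hasFDerivAt.comp_hasDerivAt _ ht

/-- Second order chain rule. -/
theorem comp {g : F → ℝ} (hg : ContDiffAt ℝ 2 g c₀) (h : HasJet γ c₀ c₁ c₂) :
    HasJet (fun t => g (γ t)) (g c₀) (fderiv ℝ g c₀ c₁)
      (fderiv ℝ (fderiv ℝ g) c₀ c₁ c₁ + fderiv ℝ g c₀ c₂) := by
  have hc := h.continuousAt
  obtain ⟨γ', h1, h2, h3, h4⟩ := h
  subst h3 h4
  refine ⟨fun t => fderiv ℝ g (γ t) (γ' t), ?_, ?_, rfl, rfl⟩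
  · have hd : ∀ᶠ y in 𝓝 (γ 0), DifferentiableAt ℝ g y :=
      (hg.eventually (by simp)).mono fun y hy => hy.differentiableAt (by simp)
    filter_upwards [h1, hc.eventually hd] with t ht hdt
    exact hdt.hasFDerivAt.comp_hasDerivAt t ht
  · have hd : DifferentiableAt ℝ (fderiv ℝ g) (γ 0) :=
      (hg.fderiv_right (m := 1) (by norm_num)).differentiableAt (by simp)
    have h5 : HasDerivAt (fun t => fderiv ℝ g (γ t)) (fderiv ℝ (fderiv ℝ g) (γ 0) (γ' 0)) 0 :=
      hd.hasFDerivAt.comp_hasDerivAt 0 h1.self_of_nhds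
    exact h5.clm_apply h2

theorem rpow {r : ℝ → ℝ} {r₁ r₂ : ℝ} (h : HasJet r 1 r₁ r₂) (β : ℝ) :
    HasJet (fun t => r t ^ β) 1 (β * r₁) (β * r₂ + β * (β - 1) * r₁ ^ 2) := by
  have hc := h.continuousAt
  obtain ⟨r', h1, h2, h3, h4⟩ := h
  subst h4
  refine ⟨fun t => r' t * β * r t ^ (β - 1), ?_, ?_, by simp [h3], by simp [h3]; ring⟩
  · have : ∀ᶠ t in 𝓝 0, r t ≠ 0 := hc.eventually_ne (by simp [h3])
    filter_upwards [h1, this] with t ht h0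
    exact ht.rpow_const (Or.inl h0)
  · have h5 := h1.self_of_nhds.rpow_const (p := β - 1) (Or.inl (by simp [h3]))
    have := (h2.mul_const β).mul h5
    simp only [h3, Real.one_rpow] at this
    convert! this using 1
    ring

/-- The second derivative is nonpositive at a local maximum. -/
theorem nonpos_of_isLocalMax {r : ℝ → ℝ} {r₀ r₁ r₂ : ℝ} (h : HasJet r r₀ r₁ r₂)
    (hmax : IsLocalMax r 0) : r₂ ≤ 0 := by
  by_contra! hpos
  -- A positive second derivative at a critical point also gives a local minimum, so `r` is locally
  -- constant and its second derivative vanishes.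
  have hmin : IsLocalMin r 0 :=
    isLocalMin_of_deriv_deriv_pos (by rwa [h.deriv_deriv_eq]) hmax.deriv_eq_zero h.continuousAt
  have heq : r =ᶠ[𝓝 0] fun _ => r 0 := by
    filter_upwards [hmax, hmin] with t h1 h2 using le_antisymm h1 h2
  have := heq.deriv.deriv_eq
  rw [h.deriv_deriv_eq] at this
  simp at this
  exact hpos.ne' this

end HasJet

section Lines

variable {E : Type*} [NormedAddCommGroup E] [InnerProductSpace ℝ E] {x e : E}

theorem hasJet_line {g : E → ℝ} (hg : ContDiffAt ℝ 2 g x) (e : E) :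
    HasJet (fun t : ℝ => g (x + t • e)) (g x) (fderiv ℝ g x e) (fderiv ℝ (fderiv ℝ g) x e e) :=
  ((HasJet.affine x e).comp hg).congr_jet rfl rfl (by simp)

theorem hasJet_norm_rpow_line (hx : ‖x‖ = 1) (he : ‖e‖ = 1) (β : ℝ) :
    HasJet (fun t : ℝ => ‖x + t • e‖ ^ β) 1 (β * inner ℝ x e)
      (β + β * (β - 2) * inner ℝ x e ^ 2) := by
  have hq : HasJet (fun t : ℝ => ‖x + t • e‖ ^ 2) 1 (2 * inner ℝ x e) 2 := by
    -- For unit vectors, `‖x + t e‖² = 1 + t (2⟨x, e⟩ + t)`.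
    have h := HasJet.add (HasJet.const (1 : ℝ)) ((HasJet.mul (HasJet.affine (0 : ℝ) 1)
      (HasJet.affine (2 * inner ℝ x e) (1 : ℝ))))
    convert! h.congr_jet (d₀ := 1) (d₁ := 2 * inner ℝ x e) (d₂ := 2) _ _ _ using 1
    · ext t
      rw [norm_add_sq_real, norm_smul, hx, he, inner_smul_right]
      simp
      ring
    all_goals simp
  have h := hq.rpow (β / 2)
  convert! h.congr_jet rfl _ _ using 1
  · ext t
    rw [← Real.rpow_natCast, ← Real.rpow_mul (norm_nonneg _)]
    congr 1
    push_cast; ring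
  · ring
  · ring

theorem laplacian_eq_sum_fderiv_fderiv [FiniteDimensional ℝ E] {ι : Type*} [Fintype ι]
    (b : OrthonormalBasis ι ℝ E) (g : E → ℝ) (x : E) :
    Laplacian.laplacian g x = ∑ i, fderiv ℝ (fderiv ℝ g) x (b i) (b i) := by
  rw [InnerProductSpace.laplacian_eq_iteratedFDeriv_orthonormalBasis g b]
  simp [iteratedFDeriv_two_apply]

end Lines

end Jets

/-! ### Homogeneous functions and Euler's identity. -/

section Homogeneous

theorem ne_zero_of_norm_eq_one {E : Type*} [NormedAddCommGroup E] {x : E} (hx : ‖x‖ = 1) : x ≠ 0 := by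
  rintro rfl; simp at hx

open Filter Topology

variable {E : Type*} [NormedAddCommGroup E] [InnerProductSpace ℝ E]
  {G : Type*} [NormedAddCommGroup G] [NormedSpace ℝ G]

/-- The function `g` is positively homogeneous of degree `k` away from the origin. -/
noncomputable def IsHomogeneousOffZero (k : ℝ) (g : E → G) : Prop :=
  ∀ t : ℝ, 0 < t → ∀ x : E, x ≠ 0 → g (t • x) = t ^ k • g x

theorem IsHomogeneousOffZero.fderiv {k : ℝ} {g : E → G} (hg : IsHomogeneousOffZero k g) :
    IsHomogeneousOffZero (k - 1) (fderiv ℝ g) := by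
  intro t ht x hx
  have h1 : (fun y => g (t • y)) =ᶠ[𝓝 x] fun y => t ^ k • g y := by
    filter_upwards [eventually_ne_nhds hx] with y hy using hg t ht y hy
  have h2 := h1.fderiv_eq (𝕜 := ℝ)
  have h3 : _root_.fderiv ℝ (fun y => t ^ k • g y) x = t ^ k • _root_.fderiv ℝ g x :=
    congrFun (fderiv_const_smul_field (𝕜 := ℝ) (f := g) (t ^ k)) x
  rw [fderiv_comp_smul, h3] at h2
  rw [Real.rpow_sub_one ht.ne', div_eq_inv_mul, mul_smul, ← h2, smul_smul, inv_mul_cancel₀ ht.ne',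
    one_smul]

/-- Euler's identity: differentiate the homogeneity relation in `t` at `t = 1`. -/
theorem IsHomogeneousOffZero.fderiv_self {k : ℝ} {g : E → G} (hg : IsHomogeneousOffZero k g)
    {x : E} (hx : x ≠ 0) (hd : DifferentiableAt ℝ g x) : _root_.fderiv ℝ g x x = k • g x := by
  have h1 : HasDerivAt (fun t : ℝ => g (t • x)) (_root_.fderiv ℝ g x x) 1 := by
    have h2 : HasFDerivAt g (_root_.fderiv ℝ g x) ((1 : ℝ) • x) := by
      rw [one_smul]; exact hd.hasFDerivAt
    have h3 := h2.comp_hasDerivAt 1 ((hasDerivAt_id (1 : ℝ)).smul_const x)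
    simpa [Function.comp_def] using h3
  have h2 : HasDerivAt (fun t : ℝ => t ^ k • g x) (k • g x) 1 := by
    have h3 := (Real.hasDerivAt_rpow_const (x := 1) (p := k) (Or.inl one_ne_zero)).smul_const (g x)
    simpa using h3
  have h3 : (fun t : ℝ => g (t • x)) =ᶠ[𝓝 1] fun t : ℝ => t ^ k • g x := by
    filter_upwards [lt_mem_nhds zero_lt_one] with t ht using hg t ht x hx
  exact h1.unique (h2.congr_of_eventuallyEq h3)

theorem IsHomogeneousOffZero.laplacian [FiniteDimensional ℝ E] {k : ℝ} {g : E → ℝ}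
    (hg : IsHomogeneousOffZero k g) : IsHomogeneousOffZero (k - 2) (Laplacian.laplacian g) := by
  intro t ht x hx
  simp_rw [laplacian_eq_sum_fderiv_fderiv (stdOrthonormalBasis ℝ E), hg.fderiv.fderiv t ht x hx,
    Finset.smul_sum]
  norm_num [sub_sub]

end Homogeneous

/-! ### Lorentz reflections on the light cone, conformal covariance, and the barrier. -/

section ConeReflection

open Filter Topology

variable {E : Type*} [NormedAddCommGroup E] [InnerProductSpace ℝ E]

/-- The Lorentz product of the light-like vector `(x, ‖x‖)` and the vector `(P, 1)`, up to sign. -/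
noncomputable def lightForm (P x : E) : ℝ := ‖x‖ - inner ℝ x P

/-- The action on the light cone `{(x, ‖x‖)}` of the Lorentz reflection in the vector `(P, 1)`.
On the unit sphere it induces the inversion which swaps the two points on each line
through `P`. -/
noncomputable def coneReflection (P x : E) : E := x + (2 / (‖P‖ ^ 2 - 1) * lightForm P x) • P

theorem continuous_lightForm : Continuous fun q : E × E => lightForm q.1 q.2 := by
  unfold lightForm; fun_prop

theorem continuous_lightForm_right (P : E) : Continuous (lightForm P) := by
  unfold lightForm; fun_prop

theorem continuous_coneReflection_right (P : E) : Continuous (coneReflection P) := by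
  have := continuous_lightForm_right P
  unfold coneReflection; fun_prop

theorem lightForm_smul (P x : E) {t : ℝ} (ht : 0 ≤ t) :
    lightForm P (t • x) = t * lightForm P x := by
  simp [lightForm, norm_smul, abs_of_nonneg ht, inner_smul_left, mul_sub]

theorem coneReflection_smul (P x : E) {t : ℝ} (ht : 0 ≤ t) :
    coneReflection P (t • x) = t • coneReflection P x := by
  rw [coneReflection, coneReflection, lightForm_smul P x ht, smul_add, smul_smul]
  congr 2; ring

/-- The right-hand side is the last coordinate of the reflected light-like vector. The sign
condition keeps it nonnegative, hence equal to the norm of the spatial part. -/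
theorem norm_coneReflection {P x : E} (hP : 1 < ‖P‖) (hx : 0 ≤ lightForm P x) :
    ‖coneReflection P x‖ = ‖x‖ + 2 / (‖P‖ ^ 2 - 1) * lightForm P x := by
  have ha : 0 < ‖P‖ ^ 2 - 1 := by nlinarith
  rw [← sq_eq_sq₀ (norm_nonneg _) (by positivity), coneReflection, norm_add_sq_real, norm_smul,
    inner_smul_right, mul_pow, Real.norm_eq_abs, sq_abs]
  have : inner ℝ x P = ‖x‖ - lightForm P x := by simp [lightForm]
  rw [this]
  field_simp
  ring

theorem norm_sub_sq_eq_lightForm {P x : E} (hx : ‖x‖ = 1) :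
    ‖x - P‖ ^ 2 = ‖P‖ ^ 2 - 1 + 2 * lightForm P x := by
  rw [norm_sub_sq_real, lightForm, hx]; ring

variable {x e P : E}

theorem hasJet_lightForm_line (hx : ‖x‖ = 1) (he : ‖e‖ = 1) :
    HasJet (fun t : ℝ => lightForm P (x + t • e)) (lightForm P x) (inner ℝ (x - P) e)
      (1 - inner ℝ x e ^ 2) := by
  have h := (hasJet_norm_rpow_line hx he 1).sub ((HasJet.affine x e).clm (innerSL ℝ P))
  convert! h.congr_jet _ _ _ using 1
  · ext t
    simp [lightForm, real_inner_comm]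
  · simp [lightForm, hx, real_inner_comm]
  · simp [inner_sub_left]
  · simp; ring

theorem hasJet_coneReflection_line (hx : ‖x‖ = 1) (he : ‖e‖ = 1) :
    HasJet (fun t : ℝ => coneReflection P (x + t • e)) (coneReflection P x)
      (e + (2 / (‖P‖ ^ 2 - 1) * inner ℝ (x - P) e) • P)
      ((2 / (‖P‖ ^ 2 - 1) * (1 - inner ℝ x e ^ 2)) • P) := by
  have h := (HasJet.affine x e).add (((HasJet.const (2 / (‖P‖ ^ 2 - 1))).mul
    (hasJet_lightForm_line (P := P) hx he)).smul (HasJet.const P))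
  exact h.congr_jet (by simp [coneReflection]) (by simp) (by simp)

section Sums

variable {ι : Type*} [Fintype ι] (b : OrthonormalBasis ι ℝ E)

theorem sum_inner_sq (x : E) : ∑ i, inner ℝ x (b i) ^ 2 = ‖x‖ ^ 2 := b.sum_sq_inner_left x

/-- Conformal covariance: for a function which is homogeneous of the conformal degree
`-(dim E - 3) / 2`, the Laplacian of `g ∘ coneReflection P` is the Laplacian of `g` at the image. -/
theorem sum_second_deriv_comp_coneReflection [FiniteDimensional ℝ E] {k : ℝ}
    (hk : 2 * k = 3 - Fintype.card ι) {g : E → ℝ} (hg : IsHomogeneousOffZero k g)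
    (hP : 1 < ‖P‖) (hx : ‖x‖ = 1) (hy : coneReflection P x ≠ 0)
    (hd : ContDiffAt ℝ 2 g (coneReflection P x)) :
    ∑ i, (fderiv ℝ (fderiv ℝ g) (coneReflection P x)
          (b i + (2 / (‖P‖ ^ 2 - 1) * inner ℝ (x - P) (b i)) • P)
          (b i + (2 / (‖P‖ ^ 2 - 1) * inner ℝ (x - P) (b i)) • P) +
        fderiv ℝ g (coneReflection P x) ((2 / (‖P‖ ^ 2 - 1) * (1 - inner ℝ x (b i) ^ 2)) • P)) =
      Laplacian.laplacian g (coneReflection P x) := by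
  have ha : 0 < ‖P‖ ^ 2 - 1 := by nlinarith
  have hsymm := (hd.isSymmSndFDerivAt (by simp)).eq
  have heuler : fderiv ℝ (fderiv ℝ g) (coneReflection P x) (coneReflection P x) P =
      (k - 1) * fderiv ℝ g (coneReflection P x) P := by
    rw [hg.fderiv.fderiv_self hy ((hd.fderiv_right (m := 1) (by norm_num)).differentiableAt
      (by simp))]
    simp
  have hxP : x - P = coneReflection P x - (1 + 2 / (‖P‖ ^ 2 - 1) * lightForm P x) • P := by
    rw [coneReflection]; module
  have hlin : ∑ i, inner ℝ (x - P) (b i) * fderiv ℝ (fderiv ℝ g) (coneReflection P x) (b i) P =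
      fderiv ℝ (fderiv ℝ g) (coneReflection P x) (x - P) P := by
    conv_rhs => rw [← b.sum_repr' (x - P)]
    simp [real_inner_comm]
  rw [laplacian_eq_sum_fderiv_fderiv b]
  have hsq := sum_inner_sq b (x - P)
  rw [norm_sub_sq_eq_lightForm hx] at hsq
  have hsx := sum_inner_sq b x
  rw [hx] at hsx
  set A := fderiv ℝ (fderiv ℝ g) (coneReflection P x)
  set D := fderiv ℝ g (coneReflection P x)
  set s := 2 / (‖P‖ ^ 2 - 1) with hs
  have hterm : ∀ i, A (b i + (s * inner ℝ (x - P) (b i)) • P)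
        (b i + (s * inner ℝ (x - P) (b i)) • P) + D ((s * (1 - inner ℝ x (b i) ^ 2)) • P) =
      A (b i) (b i) + 2 * s * (inner ℝ (x - P) (b i) * A (b i) P) +
        s ^ 2 * A P P * inner ℝ (x - P) (b i) ^ 2 + (s * D P - s * D P * inner ℝ x (b i) ^ 2) := by
    intro i
    simp only [map_add, map_smul, add_apply, smul_apply,
      smul_eq_mul, hsymm P (b i)]
    ring
  simp_rw [hterm, Finset.sum_add_distrib, Finset.sum_sub_distrib, ← Finset.mul_sum]
  rw [hlin, hsq, hsx, hxP]
  simp only [map_sub, map_smul, sub_apply, smul_apply,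
    smul_eq_mul, heuler, Finset.sum_const, Finset.card_univ, nsmul_eq_mul]
  have h2 : s * (‖P‖ ^ 2 - 1) = 2 := by rw [hs]; field_simp
  -- The `A P P` terms cancel because of the coefficient `2 / (‖P‖ ^ 2 - 1)` of a reflection, the `D
  -- P` terms because `k` is the conformal degree.
  linear_combination s ^ 1 * A P P * h2 + s * D P * hk

/-- The function `‖x‖ ^ k - N * ℓ ^ 2 * ‖x‖ ^ (k - 2)`, with `ℓ = lightForm P x`. -/
noncomputable def barrier (k N : ℝ) (P x : E) : ℝ :=
  ‖x‖ ^ k - N * (lightForm P x ^ 2 * ‖x‖ ^ (k - 2))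

/-- The velocity is left unspecified because only second derivatives enter the Laplacian. -/
theorem hasJet_barrier_line {e : E} (hx : ‖x‖ = 1) (he : ‖e‖ = 1) (k N : ℝ) :
    ∃ d, HasJet (fun t : ℝ => barrier k N P (x + t • e)) (barrier k N P x) d
      (k + k * (k - 2) * inner ℝ x e ^ 2 - N * (2 * inner ℝ (x - P) e ^ 2 +
        2 * lightForm P x * (1 - inner ℝ x e ^ 2) +
        4 * (k - 2) * lightForm P x * (inner ℝ x e ^ 2 - inner ℝ P e * inner ℝ x e) +
        lightForm P x ^ 2 * (k - 2 + (k - 2) * (k - 4) * inner ℝ x e ^ 2))) := by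
  have hl := hasJet_lightForm_line (P := P) hx he
  have h := (hasJet_norm_rpow_line hx he k).sub ((HasJet.const N).mul
    ((hl.mul hl).mul (hasJet_norm_rpow_line hx he (k - 2))))
  have hfun : (fun t : ℝ => barrier k N P (x + t • e)) = fun t : ℝ => ‖x + t • e‖ ^ k -
      N * (lightForm P (x + t • e) * lightForm P (x + t • e) * ‖x + t • e‖ ^ (k - 2)) := by
    ext t
    simp [barrier, sq]
  rw [hfun]
  exact ⟨_, h.congr_jet (by simp [barrier, sq, hx]) rfl (by simp only [inner_sub_left]; ring)⟩

/-- This is the Laplacian of the barrier at a unit vector. The term `-2 N (‖P‖ ^ 2 - 1)` makes it as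
negative as needed when `N` is a large multiple of `1 / (‖P‖ ^ 2 - 1)` and `lightForm P x` is
nonnegative and small. -/
theorem sum_second_deriv_barrier (hx : ‖x‖ = 1) {k : ℝ} (hk : 2 * k = 3 - Fintype.card ι) (N : ℝ) :
    ∑ i, (k + k * (k - 2) * inner ℝ x (b i) ^ 2 - N * (2 * inner ℝ (x - P) (b i) ^ 2 +
        2 * lightForm P x * (1 - inner ℝ x (b i) ^ 2) +
        4 * (k - 2) * lightForm P x *
          (inner ℝ x (b i) ^ 2 - inner ℝ P (b i) * inner ℝ x (b i)) +
        lightForm P x ^ 2 * (k - 2 + (k - 2) * (k - 4) * inner ℝ x (b i) ^ 2))) =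
      k * (1 - k) - N * (2 * (‖P‖ ^ 2 - 1) + 4 * (2 - k) * lightForm P x -
        (k - 2) * (k - 3) * lightForm P x ^ 2) := by
  have hsq := sum_inner_sq b (x - P)
  rw [norm_sub_sq_eq_lightForm hx] at hsq
  have hsx := sum_inner_sq b x
  rw [hx] at hsx
  have hPx : ∑ i, inner ℝ P (b i) * inner ℝ x (b i) = 1 - lightForm P x := by
    simp_rw [real_inner_comm (b _) x]
    rw [b.sum_inner_mul_inner, lightForm, hx, real_inner_comm]; ring
  simp only [Finset.sum_add_distrib, Finset.sum_sub_distrib, ← Finset.mul_sum, hsq, hsx, hPx,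
    Finset.sum_const, Finset.card_univ, nsmul_eq_mul]
  have hc : (Fintype.card ι : ℝ) = 3 - 2 * k := by linarith
  rw [hc]
  ring

end Sums

theorem isHomogeneousOffZero_barrier {k N : ℝ} {P : E} : IsHomogeneousOffZero k (barrier k N P) := by
  intro t ht x _
  have h2 : t ^ k = t ^ (k - 2) * t ^ 2 := by
    rw [← Real.rpow_natCast, ← Real.rpow_add ht]; norm_num
  simp only [barrier, norm_smul, Real.norm_eq_abs, abs_of_pos ht, lightForm_smul P x ht.le,
    Real.mul_rpow ht.le (norm_nonneg _), smul_eq_mul]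
  rw [h2]; ring

theorem coneReflection_ne_zero {P x : E} (hP : 1 < ‖P‖) (hx : x ≠ 0) (hl : 0 ≤ lightForm P x) :
    coneReflection P x ≠ 0 := by
  have ha : 0 < ‖P‖ ^ 2 - 1 := by nlinarith
  rw [← norm_pos_iff, norm_coneReflection hP hl]
  have := norm_pos_iff.2 hx
  positivity

theorem coneReflection_eq_self {P x : E} (hl : lightForm P x = 0) : coneReflection P x = x := by
  simp [coneReflection, hl]

end ConeReflection

/-! ### Homogeneous extensions from the sphere and the conformal Laplacian. -/

section Sphere

open Filter Topology

variable {n : ℕ}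

theorem normalExtension_eq (v : UnitSphere n → ℝ) {y : EuclideanSpace ℝ (Fin (n + 1))}
    (hy : y ≠ 0) : normalExtension v y = v (radialProj y hy) := by
  simp [normalExtension, hy]

theorem radialProj_coe (θ : UnitSphere n) (hθ : (θ : EuclideanSpace ℝ (Fin (n + 1))) ≠ 0) :
    radialProj (θ : EuclideanSpace ℝ (Fin (n + 1))) hθ = θ := by
  ext1
  simp [radialProj]

theorem isHomogeneousOffZero_normalExtension (v : UnitSphere n → ℝ) :
    IsHomogeneousOffZero 0 (normalExtension v) := by
  intro t ht x hx
  rw [normalExtension_eq v hx, normalExtension_eq v (smul_ne_zero ht.ne' hx), Real.rpow_zero,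
    one_smul]
  congr 1
  ext1
  simp only [radialProj, norm_smul, Real.norm_eq_abs, abs_of_pos ht, smul_smul]
  congr 1
  field_simp

/-- Off the origin the extension is `v` composed with the radial projection, which is smooth as a
map of manifolds into the sphere. -/
theorem contDiffAt_normalExtension {v : UnitSphere n → ℝ} (hv : ContMDiff (𝓡 n) 𝓘(ℝ, ℝ) 2 v)
    {x : EuclideanSpace ℝ (Fin (n + 1))} (hx : x ≠ 0) : ContDiffAt ℝ 2 (normalExtension v) x := by
  let Ω : TopologicalSpace.Opens (EuclideanSpace ℝ (Fin (n + 1))) := ⟨{0}ᶜ, isOpen_compl_singleton⟩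
  have hΩ : ∀ y : Ω, (y : EuclideanSpace ℝ (Fin (n + 1))) ≠ 0 := fun y => y.2
  have hr : ContMDiff 𝓘(ℝ, EuclideanSpace ℝ (Fin (n + 1))) 𝓘(ℝ, EuclideanSpace ℝ (Fin (n + 1))) 2
      (fun y : Ω => ‖(y : EuclideanSpace ℝ (Fin (n + 1)))‖⁻¹ •
        (y : EuclideanSpace ℝ (Fin (n + 1)))) := by
    intro y
    have hy : (y : EuclideanSpace ℝ (Fin (n + 1))) ≠ 0 := hΩ y
    have h : ContMDiffAt 𝓘(ℝ, EuclideanSpace ℝ (Fin (n + 1))) 𝓘(ℝ, EuclideanSpace ℝ (Fin (n + 1))) 2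
        (fun y : EuclideanSpace ℝ (Fin (n + 1)) => ‖y‖⁻¹ • y) y :=
      (((contDiffAt_id.norm ℝ hy).inv (norm_ne_zero_iff.2 hy)).smul contDiffAt_id).contMDiffAt
    exact contMDiffAt_subtype_iff.2 h
  have : Fact (Module.finrank ℝ (EuclideanSpace ℝ (Fin (n + 1))) = n + 1) := ⟨by simp⟩
  have hs := hr.codRestrict_sphere (n := n) (fun y => by
    simp [norm_smul, norm_ne_zero_iff.mpr (hΩ y)])
  have h : ContMDiffAt 𝓘(ℝ, EuclideanSpace ℝ (Fin (n + 1))) 𝓘(ℝ, ℝ) 2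
      (fun y : Ω => normalExtension v y) ⟨x, hx⟩ :=
    ((hv.comp hs) ⟨x, hx⟩).congr_of_eventuallyEq (Eventually.of_forall fun y =>
      normalExtension_eq v (hΩ y))
  exact (contMDiffAt_subtype_iff.1 h).contDiffAt

/-- The extension of a function on the sphere which is homogeneous of the conformal degree. -/
noncomputable def conformalExtension (v : UnitSphere n → ℝ) (x : EuclideanSpace ℝ (Fin (n + 1))) :
    ℝ :=
  ‖x‖ ^ (-(((n : ℝ) - 2) / 2)) * normalExtension v x

theorem conformalExtension_coe (v : UnitSphere n → ℝ) (θ : UnitSphere n) :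
    conformalExtension v θ = v θ := by
  rw [conformalExtension, normalExtension_eq v (ne_zero_of_mem_unit_sphere θ), radialProj_coe]
  simp

theorem isHomogeneousOffZero_conformalExtension (v : UnitSphere n → ℝ) :
    IsHomogeneousOffZero (-(((n : ℝ) - 2) / 2)) (conformalExtension v) := by
  intro t ht x hx
  rw [conformalExtension, isHomogeneousOffZero_normalExtension v t ht x hx, norm_smul,
    Real.norm_eq_abs, abs_of_pos ht, Real.mul_rpow ht.le (norm_nonneg _), conformalExtension]
  simp [mul_assoc]

theorem contDiffAt_conformalExtension {v : UnitSphere n → ℝ}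
    (hv : ContMDiff (𝓡 n) 𝓘(ℝ, ℝ) 2 v) {x : EuclideanSpace ℝ (Fin (n + 1))} (hx : x ≠ 0) :
    ContDiffAt ℝ 2 (conformalExtension v) x :=
  ((contDiffAt_id.norm ℝ hx).rpow_const_of_ne (norm_ne_zero_iff.2 hx)).mul
    (contDiffAt_normalExtension hv hx)

/-- On the unit sphere, the Laplacian of the conformal extension is the conformal Laplacian. -/
theorem laplacian_conformalExtension {v : UnitSphere n → ℝ} (hv : ContMDiff (𝓡 n) 𝓘(ℝ, ℝ) 2 v)
    (θ : UnitSphere n) :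
    Laplacian.laplacian (conformalExtension v) (θ : EuclideanSpace ℝ (Fin (n + 1))) =
      conformalLaplacian v θ := by
  have hθ : ‖(θ : EuclideanSpace ℝ (Fin (n + 1)))‖ = 1 := norm_eq_of_mem_sphere θ
  have hθ0 := ne_zero_of_mem_unit_sphere θ
  set x := (θ : EuclideanSpace ℝ (Fin (n + 1))) with hx
  have hV := contDiffAt_normalExtension hv hθ0
  have hVx : normalExtension v x = v θ := by
    rw [normalExtension_eq v hθ0, radialProj_coe]
  set k : ℝ := -(((n : ℝ) - 2) / 2) with hk
  let b := EuclideanSpace.basisFun (Fin (n + 1)) ℝ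
  have hterm : ∀ i, fderiv ℝ (fderiv ℝ (conformalExtension v)) x (b i) (b i) =
      fderiv ℝ (fderiv ℝ (normalExtension v)) x (b i) (b i) +
        2 * k * (inner ℝ x (b i) * fderiv ℝ (normalExtension v) x (b i)) +
        (k * v θ + k * (k - 2) * v θ * inner ℝ x (b i) ^ 2) := by
    intro i
    have h1 := (hasJet_line (contDiffAt_conformalExtension hv hθ0) (b i)).deriv_deriv_eq
    have h2 := ((hasJet_norm_rpow_line hθ (b.norm_eq_one i) k).mul
      (hasJet_line hV (b i))).deriv_deriv_eq
    rw [← h1]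
    refine h2.trans ?_
    rw [hVx]; ring
  -- The cross term is a radial derivative, which vanishes in degree `0`. What remains is `k (n + 1)
  -- + k (k - 2) = -n (n - 2) / 4`.
  have heuler : ∑ i, inner ℝ x (b i) * fderiv ℝ (normalExtension v) x (b i) = 0 := by
    have h := (isHomogeneousOffZero_normalExtension v).fderiv_self hθ0 (hV.differentiableAt (by simp))
    rw [zero_smul] at h
    have hsum := congrArg (fderiv ℝ (normalExtension v) x) (b.sum_repr' x)
    rw [h, map_sum] at hsum
    simpa [real_inner_comm] using hsum
  have hsx := sum_inner_sq b x
  rw [hθ] at hsx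
  rw [conformalLaplacian, sphereLaplacian, laplacian_eq_sum_fderiv_fderiv b,
    laplacian_eq_sum_fderiv_fderiv b]
  simp_rw [hterm, Finset.sum_add_distrib, ← Finset.mul_sum]
  rw [heuler, hsx]
  simp only [Finset.sum_const, Finset.card_univ, nsmul_eq_mul, Fintype.card_fin]
  rw [hk]
  push_cast
  ring

end Sphere

/-! ### The equation for the homogeneous extension, and exclusion of touching. -/

section MovingSpheres

open Filter Topology

variable {E : Type*} [NormedAddCommGroup E] [InnerProductSpace ℝ E] [FiniteDimensional ℝ E]

/-- The homogeneous extension `U` to `E \ {0}` of a positive solution of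
`-𝓛 u = u ^ p * g u` on the unit sphere, where `g` is strictly decreasing, with values in `[m, M]`
on the sphere. Here `k = -(n - 2) / 2` if `dim E = n + 1`. -/
structure IsConformalSolution (k p m M : ℝ) (g : ℝ → ℝ) (U : E → ℝ) : Prop where
  two_mul_degree : 2 * k = 3 - Module.finrank ℝ E
  degree_neg : k < 0
  degree_mul_exponent : k * p = k - 2
  strictAnti : StrictAntiOn g (Set.Ioi 0)
  homogeneous : IsHomogeneousOffZero k U
  contDiffAt : ∀ x, x ≠ 0 → ContDiffAt ℝ 2 U x
  lower_pos : 0 < m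
  lower_le : ∀ x, ‖x‖ = 1 → m ≤ U x
  le_upper : ∀ x, ‖x‖ = 1 → U x ≤ M
  equation : ∀ x, ‖x‖ = 1 → Laplacian.laplacian U x = -(U x ^ p * g (U x))

/-- Bernoulli's inequality for `a / b`, i.e. convexity: the power lies above its tangent at `b`. -/
theorem Real.rpow_sub_rpow_le_mul_sub {p a b : ℝ} (hp : 1 ≤ p) (ha : 0 ≤ a) (hb : 0 < b) :
    b ^ p - a ^ p ≤ p * b ^ (p - 1) * (b - a) := by
  have h := one_add_mul_self_le_rpow_one_add (s := a / b - 1)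
    (by have := div_nonneg ha hb.le; linarith) hp
  rw [show 1 + (a / b - 1) = a / b by ring, Real.div_rpow ha hb.le,
    le_div_iff₀ (Real.rpow_pos_of_pos hb p)] at h
  have h2 : b ^ p = b ^ (p - 1) * b := by
    rw [← Real.rpow_add_one hb.ne']; ring_nf
  have h3 : (a / b) * b ^ p = a * b ^ (p - 1) := by rw [h2]; field_simp
  linear_combination h - p * h3 + p * h2

/-- `U` dominates its reflection in the part of the unit sphere which is not visible from `P`. -/
def DominatesReflection (U : E → ℝ) (P : E) : Prop :=
  ∀ x, ‖x‖ = 1 → 0 ≤ lightForm P x → U (coneReflection P x) ≤ U x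

namespace IsConformalSolution

variable {k p m M : ℝ} {g : ℝ → ℝ} {U : E → ℝ}

theorem one_lt_exponent (sol : IsConformalSolution k p m M g U) : 1 < p := by
  nlinarith [sol.degree_neg, sol.degree_mul_exponent]

theorem eq_on_sphere (sol : IsConformalSolution k p m M g U) {x : E} (hx : x ≠ 0) :
    U (‖x‖⁻¹ • x) = ‖x‖ ^ (-k) * U x := by
  rw [sol.homogeneous _ (inv_pos.2 (norm_pos_iff.2 hx)) x hx, Real.inv_rpow (norm_nonneg _),
    Real.rpow_neg (norm_nonneg _), smul_eq_mul]

theorem lower_le_mul (sol : IsConformalSolution k p m M g U) {x : E} (hx : x ≠ 0) :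
    m ≤ ‖x‖ ^ (-k) * U x := by
  rw [← sol.eq_on_sphere hx]
  exact sol.lower_le _ (norm_smul_inv_norm hx)

theorem mul_le_upper (sol : IsConformalSolution k p m M g U) {x : E} (hx : x ≠ 0) :
    ‖x‖ ^ (-k) * U x ≤ M := by
  rw [← sol.eq_on_sphere hx]
  exact sol.le_upper _ (norm_smul_inv_norm hx)

theorem pos (sol : IsConformalSolution k p m M g U) {x : E} (hx : x ≠ 0) : 0 < U x :=
  pos_of_mul_pos_right (sol.lower_pos.trans_le (sol.lower_le_mul hx))
    (Real.rpow_nonneg (norm_nonneg _) _)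

/-- Since `k * p = k - 2`, the power `U ^ p` scales like the Laplacian; only the argument of `g`
retains a factor of the norm. That factor breaks the symmetry between `U` and its reflection. -/
theorem equation_off_sphere (sol : IsConformalSolution k p m M g U) {x : E} (hx : x ≠ 0) :
    Laplacian.laplacian U x = -(U x ^ p * g (‖x‖ ^ (-k) * U x)) := by
  have hn := norm_pos_iff.2 hx
  have h1 := sol.equation _ (norm_smul_inv_norm (𝕜 := ℝ) hx)
  have h2 := sol.homogeneous.laplacian _ (inv_pos.2 hn) x hx
  simp only [RCLike.ofReal_real_eq_id, id_eq] at h1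
  rw [h1, sol.eq_on_sphere hx, Real.mul_rpow (Real.rpow_nonneg hn.le _) (sol.pos hx).le,
    ← Real.rpow_mul hn.le, Real.inv_rpow hn.le, ← Real.rpow_neg hn.le, smul_eq_mul,
    show -k * p = -(k - 2) by linarith [sol.degree_mul_exponent]] at h2
  have h3 : 0 < ‖x‖ ^ (-(k - 2)) := Real.rpow_pos_of_pos hn _
  apply mul_left_cancel₀ h3.ne'
  rw [← h2]; ring

/-- The difference of the reflection of `U` and of `U` cannot touch a multiple of a barrier from
below. -/
theorem false_of_touching (sol : IsConformalSolution k p m M g U) {P x : E} {lam N : ℝ}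
    (hP : 1 < ‖P‖) (hx : ‖x‖ = 1) (hl : 0 < lightForm P x)
    (hmax : IsLocalMax (fun y => U (coneReflection P y) - U y - lam * barrier k N P y) x)
    (heq : U (coneReflection P x) - U x = lam * barrier k N P x)
    (hnonneg : 0 ≤ lam * barrier k N P x)
    (hbar : lam * (k * (1 - k) - N * (2 * (‖P‖ ^ 2 - 1) + 4 * (2 - k) * lightForm P x -
        (k - 2) * (k - 3) * lightForm P x ^ 2)) ≤
      -(p * M ^ (p - 1) * |g m| * (lam * barrier k N P x))) : False := by
  have ha : 0 < ‖P‖ ^ 2 - 1 := by nlinarith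
  have hx0 := ne_zero_of_norm_eq_one hx
  have hT0 := coneReflection_ne_zero hP hx0 hl.le
  have hk : 2 * k = 3 - Fintype.card (Fin (Module.finrank ℝ E)) := by
    rw [Fintype.card_fin, sol.two_mul_degree]
  let b := stdOrthonormalBasis ℝ E
  have hterm : ∀ i, (fderiv ℝ (fderiv ℝ U) (coneReflection P x)
          (b i + (2 / (‖P‖ ^ 2 - 1) * inner ℝ (x - P) (b i)) • P)
          (b i + (2 / (‖P‖ ^ 2 - 1) * inner ℝ (x - P) (b i)) • P) +
        fderiv ℝ U (coneReflection P x) ((2 / (‖P‖ ^ 2 - 1) * (1 - inner ℝ x (b i) ^ 2)) • P)) -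
      fderiv ℝ (fderiv ℝ U) x (b i) (b i) -
      lam * (k + k * (k - 2) * inner ℝ x (b i) ^ 2 - N * (2 * inner ℝ (x - P) (b i) ^ 2 +
        2 * lightForm P x * (1 - inner ℝ x (b i) ^ 2) +
        4 * (k - 2) * lightForm P x *
          (inner ℝ x (b i) ^ 2 - inner ℝ P (b i) * inner ℝ x (b i)) +
        lightForm P x ^ 2 * (k - 2 + (k - 2) * (k - 4) * inner ℝ x (b i) ^ 2))) ≤ 0 := by
    intro i
    have he := b.norm_eq_one i
    obtain ⟨d, h3⟩ := hasJet_barrier_line (P := P) hx he k N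
    have h1 := (hasJet_coneReflection_line (P := P) hx he).comp (sol.contDiffAt _ hT0)
    have h2 := hasJet_line (sol.contDiffAt x hx0) (b i)
    have h := ((h1.sub h2).sub ((HasJet.const lam).mul h3)).congr_jet rfl rfl
      (d₂ := _ - _ - lam * _) (by rw [zero_mul, add_zero, mul_zero, zero_mul, add_zero])
    refine h.nonpos_of_isLocalMax ?_
    have hc : Tendsto (fun t : ℝ => x + t • b i) (𝓝 0) (𝓝 x) := by
      have : Continuous (fun t : ℝ => x + t • b i) := by fun_prop
      simpa using this.tendsto 0
    filter_upwards [hc.eventually hmax] with t ht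
    simpa using ht
  have hsum := Finset.sum_nonpos fun i (_ : i ∈ Finset.univ) => hterm i
  rw [Finset.sum_sub_distrib, Finset.sum_sub_distrib, ← Finset.mul_sum,
    sum_second_deriv_comp_coneReflection b hk sol.homogeneous hP hx hT0 (sol.contDiffAt _ hT0),
    ← laplacian_eq_sum_fderiv_fderiv b, sum_second_deriv_barrier b hx hk,
    sol.equation_off_sphere hT0, sol.equation x hx] at hsum
  have hs : 1 < ‖coneReflection P x‖ := by
    rw [norm_coneReflection hP hl.le, hx]
    have : 0 < 2 / (‖P‖ ^ 2 - 1) * lightForm P x := by positivity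
    linarith
  have hUx := sol.pos hx0
  have hW := sol.pos hT0
  have hpow : 1 < ‖coneReflection P x‖ ^ (-k) :=
    Real.one_lt_rpow hs (by linarith [sol.degree_neg])
  have hz1 := sol.lower_le_mul hT0
  have hz2 := sol.mul_le_upper hT0
  set W := U (coneReflection P x)
  set z := ‖coneReflection P x‖ ^ (-k) * W with hz
  have hWz : W < z := by rw [hz]; nlinarith
  have hUW : U x ≤ W := by linarith
  have hp := sol.one_lt_exponent
  -- The decisive strict inequality: `U x ≤ W < z`, because the reflected point has norm greater
  -- than `1`.
  have hgz : g z < g (U x) :=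
    sol.strictAnti hUx (hUx.trans (hUW.trans_lt hWz)) (hUW.trans_lt hWz)
  have hgm : g z ≤ |g m| :=
    (sol.strictAnti.antitoneOn sol.lower_pos (sol.lower_pos.trans_le hz1) hz1).trans (le_abs_self _)
  have h1 : U x ^ p * g z < U x ^ p * g (U x) :=
    mul_lt_mul_of_pos_left hgz (Real.rpow_pos_of_pos hUx p)
  have h2 : 0 ≤ W ^ p - U x ^ p :=
    sub_nonneg.2 (Real.rpow_le_rpow hUx.le hUW (by linarith))
  have h3 : W ^ p - U x ^ p ≤ p * M ^ (p - 1) * (W - U x) := by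
    refine (Real.rpow_sub_rpow_le_mul_sub hp.le hUx.le hW).trans ?_
    have h4 : W ^ (p - 1) ≤ M ^ (p - 1) :=
      Real.rpow_le_rpow hW.le (hWz.le.trans hz2) (by linarith)
    have h5 : 0 ≤ W - U x := by linarith
    gcongr
  have h4 : (W ^ p - U x ^ p) * g z ≤ (W ^ p - U x ^ p) * |g m| :=
    mul_le_mul_of_nonneg_left hgm h2
  have h5 : (W ^ p - U x ^ p) * |g m| ≤ p * M ^ (p - 1) * (W - U x) * |g m| :=
    mul_le_mul_of_nonneg_right h3 (abs_nonneg _)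
  rw [← heq] at hbar
  linarith

end IsConformalSolution

end MovingSpheres

/-! ### The maximum principle in narrow regions, and the start of the moving spheres. -/

section MovingSpheres

open Filter Topology

variable {E : Type*} [NormedAddCommGroup E] [InnerProductSpace ℝ E] [FiniteDimensional ℝ E]

namespace IsConformalSolution

variable {k p m M : ℝ} {g : ℝ → ℝ} {U : E → ℝ}

/-- All three terms are homogeneous of degree `k`, so an inequality on the sphere extends to a full
neighbourhood of `x`, as the Euclidean Laplacian requires. -/
theorem isLocalMax_sub_barrier (sol : IsConformalSolution k p m M g U) {P x : E} {lam N : ℝ}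
    (hP : 1 < ‖P‖) (hx : ‖x‖ = 1) (hl : 0 < lightForm P x) (hb : 0 < barrier k N P x)
    (heq : U (coneReflection P x) - U x = lam * barrier k N P x)
    (hsph : ∀ y, ‖y‖ = 1 → 0 < lightForm P y → 0 < barrier k N P y →
      U (coneReflection P y) - U y ≤ lam * barrier k N P y) :
    IsLocalMax (fun y => U (coneReflection P y) - U y - lam * barrier k N P y) x := by
  have hx0 := ne_zero_of_norm_eq_one hx
  have hbc : ContinuousAt (barrier k N P) x := by
    have h1 : ContinuousAt (fun y : E => ‖y‖) x := continuous_norm.continuousAt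
    have hn : ‖x‖ ≠ 0 := norm_ne_zero_iff.2 hx0
    exact (h1.rpow_const (Or.inl hn)).sub (continuousAt_const.mul
      (((continuous_lightForm_right P).continuousAt.pow 2).mul (h1.rpow_const (Or.inl hn))))
  filter_upwards [eventually_ne_nhds hx0, hbc.eventually (lt_mem_nhds hb),
    (continuous_lightForm_right P).continuousAt.eventually (lt_mem_nhds hl)] with y hy hby hly
  have hn := norm_pos_iff.2 hy
  have hi := inv_pos.2 hn
  have hT0 := coneReflection_ne_zero hP hy hly.le
  have hpow : 0 < ‖y‖⁻¹ ^ k := Real.rpow_pos_of_pos hi k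
  have hbar : barrier k N P (‖y‖⁻¹ • y) = ‖y‖⁻¹ ^ k * barrier k N P y :=
    isHomogeneousOffZero_barrier _ hi y hy
  have h := hsph (‖y‖⁻¹ • y) (norm_smul_inv_norm hy)
    (by rw [lightForm_smul P y hi.le]; positivity) (by rw [hbar]; positivity)
  rw [coneReflection_smul P y hi.le, sol.homogeneous _ hi _ hT0, sol.homogeneous _ hi _ hy, hbar,
    smul_eq_mul, smul_eq_mul] at h
  have h2 : U (coneReflection P y) - U y ≤ lam * barrier k N P y := by
    refine le_of_mul_le_mul_left (le_of_eq_of_le ?_ (h.trans_eq ?_)) hpow <;> ring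
  rw [heq, sub_self]
  linarith

/-- There is no interior touching of `U` and its reflection. -/
theorem lt_of_dominatesReflection (sol : IsConformalSolution k p m M g U) {P x : E} (hP : 1 < ‖P‖)
    (hdom : DominatesReflection U P) (hx : ‖x‖ = 1) (hl : 0 < lightForm P x) :
    U (coneReflection P x) < U x := by
  refine lt_of_le_of_ne (hdom x hx hl.le) fun heq => ?_
  refine sol.false_of_touching (lam := 0) (N := 0) hP hx hl ?_ (by simp [heq]) (by simp) (by simp)
  refine sol.isLocalMax_sub_barrier hP hx hl (by simp [barrier, hx]) (by simp [heq]) ?_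
  intro y hy hly _
  rw [zero_mul]
  linarith [hdom y hy hly.le]

theorem continuousOn_comp_coneReflection (sol : IsConformalSolution k p m M g U) {P : E}
    (hP : 1 < ‖P‖) :
    ContinuousOn (fun x => U (coneReflection P x)) {x | ‖x‖ = 1 ∧ 0 ≤ lightForm P x} := by
  intro x hx
  have h := (sol.contDiffAt _ (coneReflection_ne_zero hP (ne_zero_of_norm_eq_one hx.1)
    hx.2)).continuousAt
  exact (h.comp (continuous_coneReflection_right P).continuousAt).continuousWithinAt

/-- Maximum principle in narrow domains. -/
theorem exists_narrow (sol : IsConformalSolution k p m M g U) :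
    ∃ c > 0, ∀ P : E, 1 < ‖P‖ →
      (∀ x, ‖x‖ = 1 → 0 ≤ lightForm P x → U x < U (coneReflection P x) →
        lightForm P x ^ 2 ≤ c * (‖P‖ ^ 2 - 1)) → DominatesReflection U P := by
  -- A unit vector is needed to know that `M` is positive; without one the claim is vacuous.
  by_cases hS : ∀ x : E, ‖x‖ ≠ 1
  · exact ⟨1, one_pos, fun P _ _ x hx => absurd hx (hS x)⟩
  push Not at hS
  obtain ⟨x₁, hx₁⟩ := hS
  have hM : 0 < M := sol.lower_pos.trans_le ((sol.lower_le x₁ hx₁).trans (sol.le_upper x₁ hx₁))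
  have hp := sol.one_lt_exponent
  have hk := sol.degree_neg
  set K := p * M ^ (p - 1) * |g m| with hK
  have hK0 : 0 ≤ K := by positivity
  have hkk : 0 < (k - 2) * (k - 3) := mul_pos_of_neg_of_neg (by linarith) (by linarith)
  -- With `N = (K + 1) / A` and `A = ‖P‖ ^ 2 - 1`, a bound `lightForm P x ^ 2 ≤ c * A` gives both `N
  -- * lightForm P x ^ 2 ≤ 1 / 2` and `(k - 2) * (k - 3) * lightForm P x ^ 2 ≤ A`: the barrier is at
  -- least `1 / 2` and its Laplacian at most `-K` times it.
  refine ⟨1 / (2 * (K + 1) + (k - 2) * (k - 3)), by positivity, fun P hP hnar => ?_⟩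
  set c := 1 / (2 * (K + 1) + (k - 2) * (k - 3)) with hc
  have hA : 0 < ‖P‖ ^ 2 - 1 := by nlinarith
  set A := ‖P‖ ^ 2 - 1 with hAdef
  have hc0 : 0 < c := by positivity
  have hc1 : c * (2 * (K + 1)) + c * ((k - 2) * (k - 3)) = 1 := by rw [hc]; field_simp
  set N := (K + 1) / A with hN
  have hNA : N * A = K + 1 := by rw [hN]; field_simp
  have hN0 : 0 < N := by positivity
  have hbar_sphere : ∀ x : E, ‖x‖ = 1 → barrier k N P x = 1 - N * lightForm P x ^ 2 := by
    intro x hx; simp [barrier, hx]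
  have hbar_half : ∀ x : E, ‖x‖ = 1 → lightForm P x ^ 2 ≤ c * A → 1 / 2 ≤ barrier k N P x := by
    intro x hx hl
    rw [hbar_sphere x hx]
    have h1 : N * lightForm P x ^ 2 ≤ N * (c * A) := by gcongr
    have h2 : N * (c * A) = c * (K + 1) := by rw [← hNA]; ring
    have h3 : 0 < c * ((k - 2) * (k - 3)) := by positivity
    linarith
  by_contra hbad
  simp only [DominatesReflection, not_forall, not_le] at hbad
  obtain ⟨x₀, hx₀, hl₀, hbad⟩ := hbad
  let S : Set E := {x | ‖x‖ = 1 ∧ 0 ≤ lightForm P x ∧ lightForm P x ^ 2 ≤ c * A}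
  have hcl := continuous_lightForm_right P
  have hScomp : IsCompact S := by
    refine (isCompact_sphere (0 : E) 1).of_isClosed_subset ?_ fun x hx => by simpa using hx.1
    exact (isClosed_eq continuous_norm continuous_const).inter
      ((isClosed_le continuous_const hcl).inter (isClosed_le (hcl.pow 2) continuous_const))
  have hcont : ContinuousOn (fun x => (U (coneReflection P x) - U x) / barrier k N P x) S := by
    refine ContinuousOn.div (ContinuousOn.sub ?_ ?_) ?_ ?_
    · exact (sol.continuousOn_comp_coneReflection hP).mono fun x hx => ⟨hx.1, hx.2.1⟩
    · exact fun x hx => (sol.contDiffAt x (ne_zero_of_norm_eq_one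
        hx.1)).continuousAt.continuousWithinAt
    · refine ContinuousOn.congr (f := fun x => 1 - N * lightForm P x ^ 2) (by fun_prop) ?_
      exact fun x hx => hbar_sphere x hx.1
    · intro x hx
      linarith [hbar_half x hx.1 hx.2.2]
  have hx₀S : x₀ ∈ S := ⟨hx₀, hl₀, hnar x₀ hx₀ hl₀ hbad⟩
  -- For the largest ratio `lam`, the function `lam * barrier` lies above `U ∘ T - U` and meets it
  -- at `x`. Outside `S` the difference is nonpositive by hypothesis.
  obtain ⟨x, hxS, hmax⟩ := hScomp.exists_isMaxOn ⟨x₀, hx₀S⟩ hcont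
  obtain ⟨hx, hl, hlA⟩ := id hxS
  have hb := hbar_half x hx hlA
  have hbpos : 0 < barrier k N P x := by linarith
  set lam := (U (coneReflection P x) - U x) / barrier k N P x with hlam
  have hlam0 : 0 < lam :=
    (div_pos (sub_pos.2 hbad) (by linarith [hbar_half x₀ hx₀ hx₀S.2.2])).trans_le (hmax hx₀S)
  have heq : U (coneReflection P x) - U x = lam * barrier k N P x := by
    rw [hlam]; field_simp
  have hlpos : 0 < lightForm P x := by
    refine lt_of_le_of_ne hl fun h => ?_
    have h1 : 0 < lam * barrier k N P x := by positivity
    rw [← heq, coneReflection_eq_self h.symm, sub_self] at h1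
    exact h1.false
  refine sol.false_of_touching (lam := lam) (N := N) hP hx hlpos ?_ heq (by positivity) ?_
  · refine sol.isLocalMax_sub_barrier hP hx hlpos hbpos heq fun y hy hly hby => ?_
    by_cases hyS : lightForm P y ^ 2 ≤ c * A
    · have h1 : (U (coneReflection P y) - U y) / barrier k N P y ≤ lam := hmax ⟨hy, hly.le, hyS⟩
      rwa [div_le_iff₀ hby] at h1
    · have h1 : U (coneReflection P y) ≤ U y := by
        by_contra! h
        exact hyS (hnar y hy hly.le h)
      have h2 : 0 < lam * barrier k N P y := by positivity
      linarith
  · rw [← hAdef, ← hK]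
    have h1 : k * (1 - k) ≤ 0 := mul_nonpos_of_nonpos_of_nonneg hk.le (by linarith)
    have h2 : (k - 2) * (k - 3) * lightForm P x ^ 2 ≤ A := by
      have h3 : (k - 2) * (k - 3) * lightForm P x ^ 2 ≤ (k - 2) * (k - 3) * (c * A) := by gcongr
      have h4 : 0 < c * (2 * (K + 1)) * A := by positivity
      linear_combination h3 + h4.le + A * hc1
    have h3 : 0 ≤ 4 * (2 - k) * lightForm P x :=
      mul_nonneg (by linarith) hl
    have h4 : N * A ≤ N * (2 * A + 4 * (2 - k) * lightForm P x -
        (k - 2) * (k - 3) * lightForm P x ^ 2) := by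
      gcongr; linarith
    have h5 : barrier k N P x ≤ 1 := by
      rw [hbar_sphere x hx]
      have : 0 ≤ N * lightForm P x ^ 2 := by positivity
      linarith
    have h6 : K * barrier k N P x ≤ K := mul_le_of_le_one_right hK0 h5
    have h7 : k * (1 - k) - N * (2 * A + 4 * (2 - k) * lightForm P x -
        (k - 2) * (k - 3) * lightForm P x ^ 2) ≤ -(K * barrier k N P x) := by linarith
    have h8 := mul_le_mul_of_nonneg_left h7 hlam0.le
    linarith

/-- `U` dominates its reflection in small spherical caps. -/
theorem exists_dominatesReflection_of_norm_le (sol : IsConformalSolution k p m M g U) :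
    ∃ δ > 0, ∀ P : E, 1 < ‖P‖ → ‖P‖ ^ 2 - 1 ≤ δ → DominatesReflection U P := by
  obtain ⟨c, hc, hnar⟩ := sol.exists_narrow
  have hm := sol.lower_pos
  have hk := sol.degree_neg
  -- At a bad point `‖T x‖ ^ (-k) * m < M`, so `‖T x‖ < s`. This bounds `lightForm P x` by `s * A /
  -- 2`, whose square is at most `c * A` once `A ≤ 4 * c / s ^ 2`. The maximum with `1` makes `s`
  -- positive without knowing the sign of `M`.
  set s := (max (M / m) 1) ^ (-k)⁻¹ with hs
  have hs0 : 0 < s := Real.rpow_pos_of_pos (lt_max_of_lt_right one_pos) _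
  refine ⟨4 * c / s ^ 2, by positivity, fun P hP hδ => hnar P hP fun x hx hl hbad => ?_⟩
  have hA : 0 < ‖P‖ ^ 2 - 1 := by nlinarith
  have hT0 := coneReflection_ne_zero hP (ne_zero_of_norm_eq_one hx) hl
  have hTn := norm_pos_iff.2 hT0
  have h1 : ‖coneReflection P x‖ ^ (-k) * m < M := by
    have h2 := sol.mul_le_upper hT0
    have h3 := sol.lower_le x hx
    have h4 : 0 < ‖coneReflection P x‖ ^ (-k) := Real.rpow_pos_of_pos hTn _
    exact (mul_lt_mul_of_pos_left (h3.trans_lt hbad) h4).trans_le h2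
  have h2 : ‖coneReflection P x‖ < s := by
    have h3 : ‖coneReflection P x‖ ^ (-k) < max (M / m) 1 :=
      lt_max_of_lt_left ((lt_div_iff₀ hm).2 h1)
    have h4 := Real.rpow_lt_rpow (by positivity) h3 (inv_pos.2 (neg_pos.2 hk))
    rwa [Real.rpow_rpow_inv hTn.le (neg_pos.2 hk).ne'] at h4
  rw [norm_coneReflection hP hl, hx] at h2
  set A := ‖P‖ ^ 2 - 1
  have h3 : lightForm P x ≤ s * A / 2 := by
    have h4 : 2 / A * lightForm P x ≤ s := by linarith
    rw [div_mul_eq_mul_div, div_le_iff₀ hA] at h4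
    linarith
  calc lightForm P x ^ 2 ≤ (s * A / 2) ^ 2 := by gcongr
    _ = s ^ 2 / 4 * A * A := by ring
    _ ≤ s ^ 2 / 4 * (4 * c / s ^ 2) * A := by gcongr
    _ = c * A := by field_simp

end IsConformalSolution

end MovingSpheres

/-! ### Continuation up to hemispheres, and the limit reflection. -/

section MovingSpheres

open Filter Topology

variable {E : Type*} [NormedAddCommGroup E] [InnerProductSpace ℝ E] [FiniteDimensional ℝ E]

namespace IsConformalSolution

variable {k p m M : ℝ} {g : ℝ → ℝ} {U : E → ℝ}

theorem continuousAt_reflection_sub (sol : IsConformalSolution k p m M g U) {P x : E}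
    (hP : 1 < ‖P‖) (hx : ‖x‖ = 1) (hl : 0 ≤ lightForm P x) :
    ContinuousAt (fun q : E × E => U (coneReflection q.1 q.2) - U q.2) (P, x) := by
  have hA : ‖P‖ ^ 2 - 1 ≠ 0 := by nlinarith
  have hx0 := ne_zero_of_norm_eq_one hx
  have hlc := continuous_lightForm (E := E)
  have hT : ContinuousAt (fun q : E × E => coneReflection q.1 q.2) (P, x) := by
    unfold coneReflection
    refine continuousAt_snd.add (ContinuousAt.smul (ContinuousAt.mul ?_ hlc.continuousAt)
      continuousAt_fst)
    exact continuousAt_const.div (by fun_prop) hA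
  have hU := (sol.contDiffAt _ (coneReflection_ne_zero hP hx0 hl)).continuousAt
  have hU2 := (sol.contDiffAt x hx0).continuousAt
  exact (ContinuousAt.comp (f := fun q : E × E => coneReflection q.1 q.2) hU hT).sub
    (ContinuousAt.comp (f := fun q : E × E => q.2) hU2 continuousAt_snd)

/-- Moving spheres: `U` dominates its reflection in every spherical cap smaller than a
hemisphere. -/
theorem dominatesReflection (sol : IsConformalSolution k p m M g U) {w : E} (hw : ‖w‖ = 1) {τ : ℝ}
    (hτ : 1 < τ) : DominatesReflection U (τ • w) := by
  obtain ⟨δ, hδ, hsmall⟩ := sol.exists_dominatesReflection_of_norm_le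
  obtain ⟨c, hc, hnar⟩ := sol.exists_narrow
  have hnorm : ∀ s : ℝ, 1 < s → ‖s • w‖ = s := fun s hs => by
    rw [norm_smul, hw, mul_one, Real.norm_eq_abs, abs_of_pos (by linarith)]
  by_contra hbad
  let B : Set ℝ := {s | 1 < s ∧ ¬ DominatesReflection U (s • w)}
  have hBne : B.Nonempty := ⟨τ, hτ, hbad⟩
  have hBlow : ∀ s ∈ B, √(1 + δ) ≤ s := by
    intro s hs
    by_contra! hlt
    refine hs.2 (hsmall _ (by rw [hnorm s hs.1]; exact hs.1) ?_)
    rw [hnorm s hs.1]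
    have h1 := (Real.lt_sqrt (by linarith [hs.1])).1 hlt
    linarith
  have hBbdd : BddBelow B := ⟨_, hBlow⟩
  set t := sInf B with ht
  have ht1 : 1 < t := by
    refine lt_of_lt_of_le ?_ (le_csInf hBne hBlow)
    rw [Real.lt_sqrt zero_le_one]
    linarith
  have hPt : 1 < ‖t • w‖ := by rwa [hnorm t ht1]
  have hcurve : Continuous fun s : ℝ => s • w := by fun_prop
  -- Failure at a given `x` is an open condition in `s`, so failure at `t` would put points below `t
  -- = sInf B` into `B`.
  have hgood : DominatesReflection U (t • w) := by
    intro x hx hl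
    by_contra! hlt
    have hlpos : 0 < lightForm (t • w) x := by
      refine lt_of_le_of_ne hl fun h => ?_
      rw [coneReflection_eq_self h.symm] at hlt
      exact hlt.false
    have hpair : Continuous fun s : ℝ => (s • w, x) := by fun_prop
    have h1 : ∀ᶠ s in 𝓝 t, 0 < lightForm (s • w) x :=
      (continuous_lightForm.comp hpair).continuousAt.eventually (lt_mem_nhds hlpos)
    have h2 : ∀ᶠ s in 𝓝 t, 0 < U (coneReflection (s • w) x) - U x :=
      (ContinuousAt.comp (f := fun s : ℝ => (s • w, x)) (sol.continuousAt_reflection_sub hPt hx hl)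
        hpair.continuousAt).eventually (lt_mem_nhds (sub_pos.2 hlt))
    have h3 : ∀ᶠ s in 𝓝[<] t, s ∈ B := by
      filter_upwards [h1.filter_mono nhdsWithin_le_nhds, h2.filter_mono nhdsWithin_le_nhds,
        (lt_mem_nhds ht1).filter_mono nhdsWithin_le_nhds] with s hs1 hs2 hs3
      exact ⟨hs3, fun hdom => by linarith [hdom x hx hs1.le]⟩
    obtain ⟨s, hsB, hst⟩ := (h3.and self_mem_nhdsWithin).exists
    exact (csInf_le hBbdd hsB).not_gt hst
  obtain ⟨s, -, hs, hsB⟩ := exists_seq_tendsto_sInf hBne hBbdd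
  -- By the narrow-region principle some violation lies at a definite distance from the fixed set of
  -- the reflection. A limit point is then a touching point with positive `lightForm`.
  have hviol : ∀ j, ∃ x, ‖x‖ = 1 ∧ 0 ≤ lightForm (s j • w) x ∧
      U x < U (coneReflection (s j • w) x) ∧
      c * (‖s j • w‖ ^ 2 - 1) < lightForm (s j • w) x ^ 2 := by
    intro j
    by_contra! h
    exact (hsB j).2 (hnar _ (by rw [hnorm _ (hsB j).1]; exact (hsB j).1) h)
  choose x hx hxl hxU hxc using hviol
  obtain ⟨x₀, hx₀, φ, hφ, hxlim⟩ := (isCompact_sphere (0 : E) 1).tendsto_subseq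
    (x := x) fun j => by simp [hx j]
  have hx₀ : ‖x₀‖ = 1 := by simpa using hx₀
  have hslim : Tendsto (fun j => s (φ j) • w) atTop (𝓝 (t • w)) :=
    (hcurve.tendsto t).comp (hs.comp hφ.tendsto_atTop)
  have hpair : Tendsto (fun j => (s (φ j) • w, x (φ j))) atTop (𝓝 (t • w, x₀)) :=
    hslim.prodMk_nhds hxlim
  have hllim : Tendsto (fun j => lightForm (s (φ j) • w) (x (φ j))) atTop
      (𝓝 (lightForm (t • w) x₀)) := (continuous_lightForm.tendsto _).comp hpair
  have hl0 : 0 ≤ lightForm (t • w) x₀ := ge_of_tendsto' hllim fun j => hxl _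
  have hlc : c * (‖t • w‖ ^ 2 - 1) ≤ lightForm (t • w) x₀ ^ 2 :=
    le_of_tendsto_of_tendsto' (((hslim.norm.pow 2).sub_const 1).const_mul c) (hllim.pow 2)
      fun j => (hxc _).le
  have hlpos : 0 < lightForm (t • w) x₀ := by
    have hA : 0 < ‖t • w‖ ^ 2 - 1 := by nlinarith
    have h1 : 0 < lightForm (t • w) x₀ ^ 2 := lt_of_lt_of_le (by positivity) hlc
    exact lt_of_le_of_ne hl0 fun h => by simp [← h] at h1
  have hU : 0 ≤ U (coneReflection (t • w) x₀) - U x₀ :=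
    ge_of_tendsto' ((sol.continuousAt_reflection_sub hPt hx₀ hl0).tendsto.comp hpair)
      fun j => (sub_pos.2 (hxU _)).le
  linarith [sol.lt_of_dominatesReflection hPt hgood hx₀ hlpos]

/-- Take `w` in the direction of `y - x`. The reflection in the hyperplane orthogonal to `w` sends
`x` to `y`, and it is the limit of the reflections with `P = τ • w`; `x` is on the side not visible
from any of these points. -/
theorem le_on_sphere (sol : IsConformalSolution k p m M g U) {x y : E} (hx : ‖x‖ = 1)
    (hy : ‖y‖ = 1) : U y ≤ U x := by
  rcases eq_or_ne x y with rfl | hne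
  · exact le_rfl
  have hd : 0 < ‖y - x‖ := norm_pos_iff.2 (sub_ne_zero.2 hne.symm)
  set w := ‖y - x‖⁻¹ • (y - x) with hw
  have hw1 : ‖w‖ = 1 := norm_smul_inv_norm (sub_ne_zero.2 hne.symm)
  have hyx : ‖y - x‖ • w = y - x := by rw [hw, smul_smul, mul_inv_cancel₀ hd.ne', one_smul]
  have hin : inner ℝ x w = -(‖y - x‖ / 2) := by
    have h1 := norm_sub_sq_real y x
    rw [hx, hy] at h1
    rw [hw, inner_smul_right, inner_sub_right, real_inner_self_eq_norm_sq, hx, real_inner_comm]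
    field_simp
    linarith
  clear_value w
  have hlf : ∀ τ : ℝ, lightForm (τ • w) x = 1 + τ * (‖y - x‖ / 2) := by
    intro τ
    rw [lightForm, hx, inner_smul_right, hin]; ring
  have hlim : Tendsto (fun τ : ℝ => coneReflection (τ • w) x) atTop (𝓝 y) := by
    have hinv : Tendsto (fun τ : ℝ => τ⁻¹) atTop (𝓝 0) := tendsto_inv_atTop_zero
    -- The reflection formula rewritten in powers of `τ⁻¹`; its limit is `x + ‖y - x‖ • w = y`.
    have h1 : Tendsto (fun τ : ℝ => x + (2 / (1 - τ⁻¹ ^ 2) * (τ⁻¹ + ‖y - x‖ / 2)) • w) atTop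
        (𝓝 (x + (2 / (1 - 0 ^ 2) * (0 + ‖y - x‖ / 2)) • w)) :=
      tendsto_const_nhds.add (((tendsto_const_nhds.div (tendsto_const_nhds.sub (hinv.pow 2))
        (by norm_num)).mul (hinv.add_const _)).smul_const w)
    have h2 : x + (2 / (1 - 0 ^ 2) * (0 + ‖y - x‖ / 2)) • w = y := by
      rw [show (2 / (1 - 0 ^ 2) * (0 + ‖y - x‖ / 2)) = ‖y - x‖ by ring, hyx]; abel
    rw [h2] at h1
    refine h1.congr' ?_
    filter_upwards [eventually_gt_atTop 1] with τ hτ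
    have hτ2 : τ ^ 2 - 1 ≠ 0 := by nlinarith
    rw [coneReflection, hlf, norm_smul, hw1, Real.norm_eq_abs, mul_one, sq_abs, smul_smul]
    congr 2
    have h3 : 1 - τ⁻¹ ^ 2 = (τ ^ 2 - 1) / τ ^ 2 := by field_simp
    rw [h3]
    field_simp
  refine le_of_tendsto (((sol.contDiffAt y (ne_zero_of_norm_eq_one hy)).continuousAt.tendsto).comp
    hlim) ?_
  filter_upwards [eventually_gt_atTop 1] with τ hτ
  refine sol.dominatesReflection hw1 hτ x hx ?_
  rw [hlf]
  positivity

end IsConformalSolution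

end MovingSpheres

/-! ### Application to the sphere. -/

section Sphere

variable {n : ℕ}

theorem isConformalSolution_conformalExtension (hn : 3 ≤ n) {f : ℝ → ℝ}
    (hdec : StrictAntiOn (fun s : ℝ => s ^ (-(((n : ℝ) + 2) / ((n : ℝ) - 2))) * f s) (Set.Ioi 0))
    {v : UnitSphere n → ℝ} (hv : ContMDiff (𝓡 n) 𝓘(ℝ, ℝ) 2 v) (hpos : ∀ θ, 0 < v θ)
    (hsol : ∀ θ, -conformalLaplacian v θ = f (v θ)) :
    ∃ m M, IsConformalSolution (-(((n : ℝ) - 2) / 2)) (((n : ℝ) + 2) / ((n : ℝ) - 2)) m M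
      (fun s : ℝ => s ^ (-(((n : ℝ) + 2) / ((n : ℝ) - 2))) * f s) (conformalExtension v) := by
  have hn3 : (3 : ℝ) ≤ n := by exact_mod_cast hn
  have hn2 : (n : ℝ) - 2 ≠ 0 := by linarith
  have hcomp : IsCompact (Set.univ : Set (UnitSphere n)) := isCompact_univ
  have hne : (Set.univ : Set (UnitSphere n)).Nonempty :=
    ⟨⟨EuclideanSpace.single 0 1, by simp⟩, trivial⟩
  -- The extrema of `v` on the compact sphere supply the bounds `m` and `M`.
  obtain ⟨θ₁, -, h₁⟩ := hcomp.exists_isMinOn hne hv.continuous.continuousOn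
  obtain ⟨θ₂, -, h₂⟩ := hcomp.exists_isMaxOn hne hv.continuous.continuousOn
  have hlift : ∀ x : EuclideanSpace ℝ (Fin (n + 1)), ‖x‖ = 1 → ∃ θ : UnitSphere n, (θ : _) = x :=
    fun x hx => ⟨⟨x, by simpa using hx⟩, rfl⟩
  refine ⟨v θ₁, v θ₂, ?_, ?_, ?_, hdec, isHomogeneousOffZero_conformalExtension v,
    fun x hx => contDiffAt_conformalExtension hv hx, hpos θ₁, fun x hx => ?_, fun x hx => ?_,
    fun x hx => ?_⟩
  · rw [finrank_euclideanSpace_fin]; push_cast; ring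
  · linarith
  · field_simp; ring
  · obtain ⟨θ, rfl⟩ := hlift x hx
    rw [conformalExtension_coe]; exact h₁ (Set.mem_univ θ)
  · obtain ⟨θ, rfl⟩ := hlift x hx
    rw [conformalExtension_coe]; exact h₂ (Set.mem_univ θ)
  · obtain ⟨θ, rfl⟩ := hlift x hx
    rw [laplacian_conformalExtension hv, conformalExtension_coe, ← mul_assoc,
      ← Real.rpow_add (hpos θ), add_neg_cancel, Real.rpow_zero, one_mul, ← hsol θ, neg_neg]

theorem sphereLaplacian_const (c : ℝ) (θ : UnitSphere n) :
    sphereLaplacian (fun _ : UnitSphere n => c) θ = 0 := by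
  have h : normalExtension (fun _ : UnitSphere n => c) =ᶠ[nhds
      (θ : EuclideanSpace ℝ (Fin (n + 1)))] fun _ => c := by
    filter_upwards [eventually_ne_nhds (ne_zero_of_mem_unit_sphere θ)] with y hy
    exact normalExtension_eq _ hy
  have h2 := (InnerProductSpace.laplacian_congr_nhds h).self_of_nhds
  rw [sphereLaplacian, h2, InnerProductSpace.laplacian_const]
  rfl

end Sphere

theorem corollary1p3 (n : ℕ) (hn : 3 ≤ n) (f : ℝ → ℝ)
    (hf : ContinuousOn f (Set.Ici 0))
    (hdec : StrictAntiOn (fun s : ℝ => s ^ (-(((n : ℝ) + 2) / ((n : ℝ) - 2))) * f s) (Set.Ioi 0))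
    (v : UnitSphere n → ℝ) (hv : ContMDiff (𝓡 n) 𝓘(ℝ, ℝ) 2 v) (hpos : ∀ θ, 0 < v θ)
    (hsol : ∀ θ, -conformalLaplacian v θ = f (v θ)) :
    ∃ c : ℝ, (∀ θ, v θ = c) ∧ f c = (n : ℝ) * ((n : ℝ) - 2) / 4 * c := by
  obtain ⟨m, M, sol⟩ := isConformalSolution_conformalExtension hn hdec hv hpos hsol
  let θ₀ : UnitSphere n := ⟨EuclideanSpace.single 0 1, by simp⟩
  have hconst : ∀ θ, v θ = v θ₀ := by
    intro θ
    have h₀ : ‖(θ₀ : EuclideanSpace ℝ (Fin (n + 1)))‖ = 1 := norm_eq_of_mem_sphere θ₀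
    have h₁ : ‖(θ : EuclideanSpace ℝ (Fin (n + 1)))‖ = 1 := norm_eq_of_mem_sphere θ
    rw [← conformalExtension_coe v θ, ← conformalExtension_coe v θ₀]
    exact le_antisymm (sol.le_on_sphere h₀ h₁) (sol.le_on_sphere h₁ h₀)
  refine ⟨v θ₀, hconst, ?_⟩
  have hlap : sphereLaplacian v θ₀ = 0 := by
    rw [show v = fun _ => v θ₀ from funext hconst, sphereLaplacian_const]
  rw [← hsol θ₀, conformalLaplacian, hlap]
  ring
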